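/- Let $f:\mathbb R^n\times\mathbb R^p\to\mathbb R$, $(x,\theta)\mapsto f(x,\theta)$, be twice continuously differentiable, let $g_1,\dots,g_m:\mathbb R^n\to\mathbb R$ be convex and $h_1,\dots,h_\ell:\mathbb R^n\to\mathbb R$ affine, and let $\mathcal X=\{x: g_i(x)\le 0\ (i\le m),\ h_j(x)=0\ (j\le \ell)\}$. Assume that some $x\in\mathcal X$ satisfies $g_i(x)<0$ for all $i$. Write $\nabla$ and $\nabla^2$ for the gradient and the Hessian with respect to $x$. Call $x\in\mathcal X$ a strict local minimizer of $f(\cdot,\theta)$ over $\mathcal X$ if the $g_i$ are differentiable at $x$, there are $\mu\in\mathbb R^m_{\ge 0}$ and $\nu\in\mathbb R^\ell$ with $\nabla f(x,\theta)+\sum_i\mu_i\nabla g_i(x)+\sum_j\nu_j\nabla h_j(x)=0$ and $\mu_i g_i(x)=0$ for all $i$, and $\nabla^2 f(x,\theta)\succ 0$. Then there is a Lebesgue-null set $N\subset\mathbb R^p$ such that for every $\theta_0\in\mathbb R^p$ and every strict local minimizer $x$ of $f(\cdot,\theta_0)$ over $\mathcal X$ there are an open convex neighborhood $\mathcal I$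 of $x$ and an open neighborhood $U$ of $\theta_0$ with the following properties. 1. For every $\theta\in U$ the function $f(\cdot,\theta)$ has exactly one minimizer $x^*_{\mathcal I}(\theta)$ over $\mathcal I\cap\mathcal X$; moreover $x^*_{\mathcal I}(\theta_0)=x$. 2. The map $x^*_{\mathcal I}$ is differentiable at every $\theta\in U\setminus N$. 3. For every $\theta_1\in U$, put $x_1=x^*_{\mathcal I}(\theta_1)$. For all $\theta$ near $\theta_1$ the local quadratic approximation $$\min_{y\in\mathcal X}\ \tfrac12 (y-x_1)^\top\nabla^2 f(x_1,\theta)(y-x_1)+(y-x_1)^\top\nabla f(x_1,\theta)$$ has exactly one solution $y^*(\theta)$. The map $x^*_{\mathcal I}$ is differentiable at $\theta_1$ if and only if $y^*$ is, and then their derivatives with respect to $\theta$ at $\theta_1$ coincide. In particular, if $\theta_0\notin N$, then $x^*_{\mathcal I}$ is differentiable at $\theta_0$ and its derivative there is that of the solution of the local quadratic approximation around $x$. -/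

import Mathlib

open Set Filter Topology MeasureTheory

noncomputable section

/-- The feasible set `{x : g₁(x), …, g_m(x) ≤ 0, h₁(x) = … = h_ℓ(x) = 0}`. -/
def feasibleSet {n m l : ℕ} (g : Fin m → EuclideanSpace ℝ (Fin n) → ℝ)
    (h : Fin l → EuclideanSpace ℝ (Fin n) →ᵃ[ℝ] ℝ) : Set (EuclideanSpace ℝ (Fin n)) :=
  {x | (∀ i, g i x ≤ 0) ∧ ∀ j, h j x = 0}

/-- The Hessian `∇²φ(x)` of a real function, as the derivative of its gradient. -/
def hessian {n : ℕ} (φ : EuclideanSpace ℝ (Fin n) → ℝ) (x : EuclideanSpace ℝ (Fin n)) :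
    EuclideanSpace ℝ (Fin n) →L[ℝ] EuclideanSpace ℝ (Fin n) :=
  fderiv ℝ (gradient φ) x

/-- `x` is a strict local minimizer of `φ` over the set cut out by `g ≤ 0`, `h = 0`: it is a
feasible Karush-Kuhn-Tucker point at which the Hessian of `φ` is positive definite.
The field `diff` says that the gradients `∇gᵢ(x)` in the stationarity condition exist. -/
structure IsStrictLocalMinimizer {n m l : ℕ} (φ : EuclideanSpace ℝ (Fin n) → ℝ)
    (g : Fin m → EuclideanSpace ℝ (Fin n) → ℝ)
    (h : Fin l → EuclideanSpace ℝ (Fin n) →ᵃ[ℝ] ℝ) (x : EuclideanSpace ℝ (Fin n)) : Prop where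
  feasible : x ∈ feasibleSet g h
  diff : ∀ i, DifferentiableAt ℝ (g i) x
  kkt : ∃ (μ : Fin m → ℝ) (ν : Fin l → ℝ), (∀ i, 0 ≤ μ i) ∧
    gradient φ x + ∑ i, μ i • gradient (g i) x + ∑ j, ν j • gradient (fun y => h j y) x = 0 ∧
    ∀ i, μ i * g i x = 0
  posDef : ∀ v : EuclideanSpace ℝ (Fin n), v ≠ 0 → 0 < inner ℝ v (hessian φ x v)

/-- The set of all minimizers of `φ` over `S`. -/
def argminSet {n : ℕ} (φ : EuclideanSpace ℝ (Fin n) → ℝ) (S : Set (EuclideanSpace ℝ (Fin n))) :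
    Set (EuclideanSpace ℝ (Fin n)) :=
  {y | y ∈ S ∧ ∀ z ∈ S, φ y ≤ φ z}

/-- The second-order Taylor approximation of `φ` around `x`, without its constant term:
`y ↦ ½ (y - x)ᵀ ∇²φ(x) (y - x) + (y - x)ᵀ ∇φ(x)`. -/
def localQuadratic {n : ℕ} (φ : EuclideanSpace ℝ (Fin n) → ℝ) (x y : EuclideanSpace ℝ (Fin n)) :
    ℝ :=
  (1 / 2 : ℝ) * inner ℝ (y - x) (hessian φ x (y - x)) + inner ℝ (y - x) (gradient φ x)

end

/-! Convexity turns the Karush-Kuhn-Tucker conditions into the variational inequality (VI) of `G =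
∇f` over the closed convex set `K`. Where the Hessian is positive definite, `G(·, θ)` is strongly
monotone, uniformly near the point. So the VI has a locally unique solution, Lipschitz in `θ`, which
is also the local minimizer (`exists_isLocalSolutionMap`).

By Rademacher each such map is differentiable almost everywhere. The pairs `(x, θ)` that solve the
VI with positive definite Hessian are covered by countably many boxes carrying such maps, and by
local uniqueness every other local solution map agrees with one of these near each parameter. Hence
a single null set suffices (`exists_null_set_differentiableAt`).

The quadratic problem is the VI of the linearization of `G(·, θ)` at `x₁`. At `s θ` the two
operators differ by `o(‖s θ - x₁‖) = o(‖θ - θ₁‖)`, and strong monotonicity passes this bound to the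
solutions (`isLittleO_sub_linearized_solution`). Two maps this close have the same derivatives, with
no analysis of active constraints. -/

section

/-! ### Strongly monotone variational inequalities and their local solution maps -/

variable {E P : Type*} [NormedAddCommGroup E] [InnerProductSpace ℝ E]
  [NormedAddCommGroup P] [NormedSpace ℝ P]

/-- The pair `z = (x, θ)` solves the variational inequality of `G` over `K`. -/
def IsVISolution (G : E × P → E) (K : Set E) (z : E × P) : Prop :=
  z.1 ∈ K ∧ ∀ y ∈ K, 0 ≤ inner ℝ (G z) (y - z.1)

/-- `s` is a Lipschitz map on `U` whose values are the unique solutions in `I`, both of the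
minimization of `φ · θ` over `I ∩ K` and of the variational inequality, with a positive definite
derivative of `G`. -/
structure IsLocalSolutionMap (φ : E → P → ℝ) (G : E × P → E) (K I : Set E) (U : Set P)
    (s : P → E) : Prop where
  isOpen_left : IsOpen I
  convex : Convex ℝ I
  isOpen_right : IsOpen U
  mem : ∀ θ ∈ U, s θ ∈ I ∩ K
  isMinOn : ∀ θ ∈ U, ∀ y ∈ I ∩ K, φ (s θ) θ ≤ φ y θ
  unique_min : ∀ θ ∈ U, ∀ z ∈ I ∩ K, (∀ y ∈ I ∩ K, φ z θ ≤ φ y θ) → z = s θ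
  vi : ∀ θ ∈ U, IsVISolution G K (s θ, θ)
  unique : ∀ θ ∈ U, ∀ z ∈ I, IsVISolution G K (z, θ) → z = s θ
  lipschitz : ∃ C, LipschitzOnWith C s U
  posDef : ∀ θ ∈ U, ∀ z ∈ I, ∀ v ≠ 0, 0 < inner ℝ v (fderiv ℝ G (z, θ) (v, 0))

lemma exists_coercive [FiniteDimensional ℝ E] (A : E →L[ℝ] E)
    (hA : ∀ v ≠ 0, 0 < inner ℝ v (A v)) : ∃ c > 0, ∀ v, c * ‖v‖ ^ 2 ≤ inner ℝ v (A v) := by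
  rcases (Metric.sphere (0 : E) 1).eq_empty_or_nonempty with h | h
  · refine ⟨1, one_pos, fun v => ?_⟩
    have : v = 0 := by
      by_contra hv
      have : ‖v‖⁻¹ • v ∈ Metric.sphere (0 : E) 1 := by
        simp [norm_smul, hv]
      simp [h] at this
    simp [this]
  · obtain ⟨w, hw, hmin⟩ := (isCompact_sphere (0 : E) 1).exists_isMinOn h
      (f := fun v => inner ℝ v (A v)) (by fun_prop)
    have hw1 : ‖w‖ = 1 := by simpa using hw
    refine ⟨inner ℝ w (A w), hA w (by rintro rfl; simp at hw1), fun v => ?_⟩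
    by_cases hv : v = 0
    · simp [hv]
    have hn : ‖v‖ ≠ 0 := norm_ne_zero_iff.2 hv
    have hm : ‖v‖⁻¹ • v ∈ Metric.sphere (0 : E) 1 := by
      simp [norm_smul, hv]
    have := hmin hm
    simp only [mem_ofPred_eq, map_smul, real_inner_smul_left, real_inner_smul_right] at this
    calc _ ≤ (‖v‖⁻¹ * (‖v‖⁻¹ * inner ℝ v (A v))) * ‖v‖ ^ 2 := by gcongr
      _ = _ := by field_simp

/-- Makes coercivity an open condition, so that a bound at one point holds nearby with half the
constant. -/
lemma coercive_of_norm_sub_le {A B : E →L[ℝ] E} {c : ℝ}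
    (hA : ∀ v, c * ‖v‖ ^ 2 ≤ inner ℝ v (A v)) (hB : ‖B - A‖ ≤ c / 2) (v : E) :
    c / 2 * ‖v‖ ^ 2 ≤ inner ℝ v (B v) := by
  have h1 : |inner ℝ v ((B - A) v)| ≤ ‖v‖ * (c / 2 * ‖v‖) :=
    (abs_real_inner_le_norm _ _).trans (by gcongr; exact (B - A).le_of_opNorm_le hB v)
  have h2 : inner ℝ v ((B - A) v) = inner ℝ v (B v) - inner ℝ v (A v) := by
    simp [inner_sub_right]
  have := hA v
  have := neg_le_of_abs_le h1
  nlinarith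

/-- The derivative at a minimizer over a convex set is nonnegative in feasible directions. -/
lemma fderiv_nonneg_of_forall_le {q : E → ℝ} {q' : E →L[ℝ] ℝ} {K : Set E} {x y : E}
    (hK : Convex ℝ K) (hx : x ∈ K) (hy : y ∈ K) (hmin : ∀ z ∈ K, q x ≤ q z)
    (hq : HasFDerivAt q q' x) : 0 ≤ q' (y - x) := by
  have : IsLocalMinOn q K x := IsMinOn.localize (fun z hz => hmin z hz)
  exact this.hasFDerivWithinAt_nonneg hq.hasFDerivWithinAt
    (sub_mem_posTangentConeAt_of_segment_subset (hK.segment_subset hx hy))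

lemma inner_gradient_nonneg_of_forall_le [CompleteSpace E] {q : E → ℝ} {q' : E} {K : Set E}
    {x y : E} (hK : Convex ℝ K) (hx : x ∈ K) (hy : y ∈ K) (hmin : ∀ z ∈ K, q x ≤ q z)
    (hq : HasGradientAt q q' x) : 0 ≤ inner ℝ q' (y - x) := by
  simpa using fderiv_nonneg_of_forall_le hK hx hy hmin hq.hasFDerivAt

/-- Optimality in a neighbourhood is enough for the variational inequality over a convex set. -/
lemma inner_nonneg_of_inter_nhds {K I : Set E} {x a : E} (hK : Convex ℝ K) (hx : x ∈ K)
    (hI : I ∈ 𝓝 x) (h : ∀ y ∈ I ∩ K, 0 ≤ inner ℝ a (y - x)) :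
    ∀ y ∈ K, 0 ≤ inner ℝ a (y - x) := by
  intro y hy
  have hc : Tendsto (fun ε : ℝ => x + ε • (y - x)) (𝓝[>] 0) (𝓝 x) := by
    have : Continuous (fun ε : ℝ => x + ε • (y - x)) := by fun_prop
    simpa using (this.tendsto 0).mono_left nhdsWithin_le_nhds
  have hlt : ∀ᶠ ε : ℝ in 𝓝[>] 0, ε < 1 :=
    nhdsWithin_le_nhds (Iio_mem_nhds one_pos)
  obtain ⟨ε, hεI, hε1, hε0⟩ :=
    ((hc.eventually hI).and (hlt.and self_mem_nhdsWithin)).exists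
  have hε0 : 0 < ε := hε0
  have := h _ ⟨hεI, hK.add_smul_sub_mem hx hy ⟨hε0.le, hε1.le⟩⟩
  rw [add_sub_cancel_left, real_inner_smul_right] at this
  exact nonneg_of_mul_nonneg_right this hε0

/-- Solutions of strongly monotone variational inequalities depend Lipschitz continuously on the
operator. -/
lemma norm_sub_le_of_strongly_monotone {G₁ G₂ : E → E} {x y : E} {c L : ℝ} (hc : 0 < c)
    (hmono : c * ‖x - y‖ ^ 2 ≤ inner ℝ (G₁ x - G₁ y) (x - y))
    (hx : 0 ≤ inner ℝ (G₁ x) (y - x)) (hy : 0 ≤ inner ℝ (G₂ y) (x - y))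
    (hL : ‖G₁ y - G₂ y‖ ≤ L) : ‖x - y‖ ≤ L / c := by
  have h1 : |inner ℝ (G₁ y - G₂ y) (x - y)| ≤ L * ‖x - y‖ :=
    (abs_real_inner_le_norm _ _).trans (by gcongr)
  have h2 := neg_le_of_abs_le h1
  have h3 : c * ‖x - y‖ ^ 2 ≤ L * ‖x - y‖ := by
    rw [← neg_sub x y, inner_neg_right] at hx
    rw [inner_sub_left] at hmono h2
    linarith
  rw [le_div_iff₀ hc]
  by_contra! hlt
  -- When `x = y` one cannot divide by the norm; `0 ≤ L` from `hL` is enough.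
  rcases (norm_nonneg (x - y)).eq_or_lt with h0 | h0
  · rw [← h0] at hlt
    have := (norm_nonneg _).trans hL
    linarith
  · nlinarith

/-- Strict differentiability of `G` at `(x₀, θ₀)` gives strong monotonicity in `x` and a Lipschitz
bound in `θ` on one product of balls. Existence comes from compactness, uniqueness and the Lipschitz
property from monotonicity. -/
theorem exists_isLocalSolutionMap [FiniteDimensional ℝ E] {φ : E → P → ℝ} {G : E × P → E}
    {K : Set E} (hφ : ∀ x θ, HasGradientAt (fun y => φ y θ) (G (x, θ)) x) (hG : ContDiff ℝ 1 G)
    (hKc : IsClosed K) (hK : Convex ℝ K) {x₀ : E} {θ₀ : P} (hvi : IsVISolution G K (x₀, θ₀))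
    (hpos : ∀ v ≠ 0, 0 < inner ℝ v (fderiv ℝ G (x₀, θ₀) (v, 0))) :
    ∃ I U s, IsLocalSolutionMap φ G K I U s ∧ x₀ ∈ I ∧ θ₀ ∈ U ∧ s θ₀ = x₀ := by
  set j : E →L[ℝ] E × P := ContinuousLinearMap.inl ℝ E P with hj
  set A := (fderiv ℝ G (x₀, θ₀)).comp j with hA
  obtain ⟨c, hc, hcA⟩ := exists_coercive A (by simpa [A, j] using hpos)
  have hstrict : HasStrictFDerivAt G (fderiv ℝ G (x₀, θ₀)) (x₀, θ₀) :=
    hG.contDiffAt.hasStrictFDerivAt one_ne_zero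
  have hcont : Continuous fun z => (fderiv ℝ G z).comp j :=
    (hG.continuous_fderiv one_ne_zero).clm_comp continuous_const
  have hev1 : ∀ᶠ z in 𝓝 (x₀, θ₀), ‖(fderiv ℝ G z).comp j - A‖ < c / 2 := by
    have := Metric.tendsto_nhds.1 (hcont.tendsto (x₀, θ₀)) (c / 2) (by positivity)
    simpa [dist_eq_norm] using this
  have hev2 : ∀ᶠ w in 𝓝 ((x₀, θ₀), (x₀, θ₀)),
      ‖G w.1 - G w.2 - fderiv ℝ G (x₀, θ₀) (w.1 - w.2)‖ ≤ c / 2 * ‖w.1 - w.2‖ :=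
    hstrict.isLittleO.bound (by positivity)
  obtain ⟨r₁, hr₁, h1⟩ := Metric.eventually_nhds_iff.1 hev1
  obtain ⟨r₂, hr₂, h2⟩ := Metric.eventually_nhds_iff.1 hev2
  -- Strictly below both radii, so that the closed ball is still covered by the estimates.
  obtain ⟨r, hr, hrr⟩ : ∃ r > 0, r < min r₁ r₂ := exists_between (lt_min hr₁ hr₂)
  have hrr₁ := hrr.trans_le (min_le_left _ _)
  have hrr₂ := hrr.trans_le (min_le_right _ _)
  set L := ‖fderiv ℝ G (x₀, θ₀)‖ + c / 2 with hL
  have hL0 : 0 < L := by positivity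
  -- `L * δ / (c / 2)` bounds how far a solution can move from `x₀`; being below `r`, it keeps
  -- minimizers off the sphere.
  obtain ⟨δ, hδ, hδr, hδL⟩ : ∃ δ > 0, δ < r ∧ L * δ / (c / 2) < r := by
    refine ⟨min (r / 2) (r * (c / 2) / (2 * L)), by positivity,
      (min_le_left _ _).trans_lt (by linarith), ?_⟩
    calc _ ≤ L * (r * (c / 2) / (2 * L)) / (c / 2) := by gcongr; exact min_le_right _ _
      _ = r / 2 := by field_simp
      _ < r := by linarith
  have hx₀K : x₀ ∈ K := hvi.1
  have hbd : ∀ x ∈ Metric.closedBall x₀ r, ∀ y ∈ Metric.closedBall x₀ r, ∀ θ ∈ Metric.ball θ₀ δ,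
      ∀ η ∈ Metric.ball θ₀ δ, ‖G (x, θ) - G (y, η) - fderiv ℝ G (x₀, θ₀) (x - y, θ - η)‖ ≤
        c / 2 * ‖(x - y, θ - η)‖ := by
    intro x hx y hy θ hθ η hη
    rw [Metric.mem_closedBall] at hx hy
    rw [Metric.mem_ball] at hθ hη
    refine @h2 ((x, θ), (y, η)) ?_
    simp only [Prod.dist_eq, max_lt_iff]
    refine ⟨⟨?_, ?_⟩, ?_, ?_⟩ <;> linarith
  have hmono : ∀ x ∈ Metric.closedBall x₀ r, ∀ y ∈ Metric.closedBall x₀ r, ∀ θ ∈ Metric.ball θ₀ δ,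
      c / 2 * ‖x - y‖ ^ 2 ≤ inner ℝ (G (x, θ) - G (y, θ)) (x - y) := by
    intro x hx y hy θ hθ
    have hb := hbd x hx y hy θ hθ θ hθ
    simp only [sub_self, Prod.norm_mk, norm_zero, norm_nonneg, sup_of_le_left] at hb
    have hi : |inner ℝ (G (x, θ) - G (y, θ) - fderiv ℝ G (x₀, θ₀) (x - y, 0)) (x - y)| ≤
        c / 2 * ‖x - y‖ * ‖x - y‖ := (abs_real_inner_le_norm _ _).trans (by gcongr)
    have hi' := neg_le_of_abs_le hi
    rw [inner_sub_left] at hi'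
    have := hcA (x - y)
    rw [real_inner_comm] at this
    have e : A (x - y) = fderiv ℝ G (x₀, θ₀) (x - y, 0) := by simp [A, j]
    rw [e] at this
    nlinarith
  have hlip : ∀ x ∈ Metric.closedBall x₀ r, ∀ θ ∈ Metric.ball θ₀ δ, ∀ η ∈ Metric.ball θ₀ δ,
      ‖G (x, θ) - G (x, η)‖ ≤ L * ‖θ - η‖ := by
    intro x hx θ hθ η hη
    have hb := hbd x hx x hx θ hθ η hη
    have hn : ‖((x - x, θ - η) : E × P)‖ = ‖θ - η‖ := by simp
    have h3 := (fderiv ℝ G (x₀, θ₀)).le_opNorm (x - x, θ - η)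
    rw [hn] at hb h3
    calc _ ≤ ‖G (x, θ) - G (x, η) - fderiv ℝ G (x₀, θ₀) (x - x, θ - η)‖ +
          ‖fderiv ℝ G (x₀, θ₀) (x - x, θ - η)‖ := by
          simpa using norm_add_le (G (x, θ) - G (x, η) - fderiv ℝ G (x₀, θ₀) (x - x, θ - η))
            (fderiv ℝ G (x₀, θ₀) (x - x, θ - η))
      _ ≤ L * ‖θ - η‖ := by rw [hL]; linarith
  have hθ₀ : θ₀ ∈ Metric.ball θ₀ δ := Metric.mem_ball_self hδ
  have hx₀ : x₀ ∈ Metric.closedBall x₀ r := Metric.mem_closedBall_self hr.le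
  have hc2 : 0 < c / 2 := by positivity
  have hex : ∀ θ ∈ Metric.ball θ₀ δ, ∃ z ∈ Metric.ball x₀ r ∩ K,
      ∀ y ∈ Metric.ball x₀ r ∩ K, φ z θ ≤ φ y θ := by
    intro θ hθ
    have hcomp : IsCompact (Metric.closedBall x₀ r ∩ K) :=
      (isCompact_closedBall x₀ r).inter_right hKc
    have hcφ : Continuous fun y => φ y θ :=
      continuous_iff_continuousAt.2 fun y => (hφ y θ).continuousAt
    obtain ⟨z, hz, hzmin⟩ := hcomp.exists_isMinOn ⟨x₀, hx₀, hx₀K⟩ hcφ.continuousOn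
    have hz0 : 0 ≤ inner ℝ (G (z, θ)) (x₀ - z) :=
      inner_gradient_nonneg_of_forall_le ((convex_closedBall x₀ r).inter hK) hz ⟨hx₀, hx₀K⟩
        (fun y hy => hzmin hy) (hφ z θ)
    -- Comparison with `x₀`, the solution at `θ₀`, puts the minimizer over the closed ball inside
    -- the open one.
    have hd := norm_sub_le_of_strongly_monotone (G₁ := fun x => G (x, θ))
      (G₂ := fun x => G (x, θ₀)) hc2 (hmono z hz.1 x₀ hx₀ θ hθ) hz0 (hvi.2 z hz.2)
      (hlip x₀ hx₀ θ hθ θ₀ hθ₀)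
    refine ⟨z, ⟨?_, hz.2⟩, fun y hy => hzmin ⟨Metric.ball_subset_closedBall hy.1, hy.2⟩⟩
    rw [Metric.mem_ball, dist_eq_norm]
    refine (hd.trans ?_).trans_lt hδL
    rw [Metric.mem_ball, dist_eq_norm] at hθ
    gcongr
  have hmin_vi : ∀ θ, ∀ z ∈ Metric.ball x₀ r ∩ K,
      (∀ y ∈ Metric.ball x₀ r ∩ K, φ z θ ≤ φ y θ) → IsVISolution G K (z, θ) := by
    intro θ z hz hzmin
    exact ⟨hz.2, inner_nonneg_of_inter_nhds hK hz.2 (Metric.isOpen_ball.mem_nhds hz.1)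
      fun y hy => inner_gradient_nonneg_of_forall_le ((convex_ball x₀ r).inter hK) hz hy
        hzmin (hφ z θ)⟩
  have hdist : ∀ θ ∈ Metric.ball θ₀ δ, ∀ η ∈ Metric.ball θ₀ δ, ∀ z ∈ Metric.ball x₀ r,
      ∀ w ∈ Metric.ball x₀ r, IsVISolution G K (z, θ) → IsVISolution G K (w, η) →
      ‖z - w‖ ≤ L * ‖θ - η‖ / (c / 2) := by
    intro θ hθ η hη z hz w hw hzv hwv
    exact norm_sub_le_of_strongly_monotone (G₁ := fun x => G (x, θ))
      (G₂ := fun x => G (x, η)) hc2 (hmono z (Metric.ball_subset_closedBall hz) w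
      (Metric.ball_subset_closedBall hw) θ hθ) (hzv.2 w hwv.1) (hwv.2 z hzv.1)
      (hlip w (Metric.ball_subset_closedBall hw) θ hθ η hη)
  have huniq : ∀ θ ∈ Metric.ball θ₀ δ, ∀ z ∈ Metric.ball x₀ r, ∀ w ∈ Metric.ball x₀ r,
      IsVISolution G K (z, θ) → IsVISolution G K (w, θ) → z = w := by
    intro θ hθ z hz w hw hzv hwv
    have := hdist θ hθ θ hθ z hz w hw hzv hwv
    simp only [sub_self, norm_zero, mul_zero, zero_div, norm_le_zero_iff] at this
    exact sub_eq_zero.1 this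
  choose! s hs hsmin using hex
  have hsvi : ∀ θ ∈ Metric.ball θ₀ δ, IsVISolution G K (s θ, θ) :=
    fun θ hθ => hmin_vi θ _ (hs θ hθ) (hsmin θ hθ)
  refine ⟨Metric.ball x₀ r, Metric.ball θ₀ δ, s, ⟨Metric.isOpen_ball, convex_ball _ _,
    Metric.isOpen_ball, hs, hsmin, ?_, hsvi, ?_, ?_, ?_⟩, Metric.mem_ball_self hr, hθ₀, ?_⟩
  · intro θ hθ z hz hzmin
    exact huniq θ hθ z hz.1 _ (hs θ hθ).1 (hmin_vi θ z hz hzmin) (hsvi θ hθ)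
  · intro θ hθ z hz hzv
    exact huniq θ hθ z hz _ (hs θ hθ).1 hzv (hsvi θ hθ)
  · refine ⟨Real.toNNReal (L / (c / 2)), LipschitzOnWith.of_dist_le_mul fun θ hθ η hη => ?_⟩
    rw [Real.coe_toNNReal _ (by positivity), dist_eq_norm, dist_eq_norm]
    refine (hdist θ hθ η hη _ (hs θ hθ).1 _ (hs η hη).1 (hsvi θ hθ) (hsvi η hη)).trans_eq ?_
    ring
  -- Positive definiteness on the whole box, not only at `(x₀, θ₀)`, is what later places every `(s
  -- θ, θ)` in the set `M`.
  · intro θ hθ z hz v hv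
    have hzθ : ‖(fderiv ℝ G (z, θ)).comp j - A‖ < c / 2 := by
      refine h1 ?_
      rw [Metric.mem_ball] at hz hθ
      simp only [Prod.dist_eq, max_lt_iff]
      constructor <;> linarith
    have := coercive_of_norm_sub_le hcA hzθ.le v
    have hv' : 0 < ‖v‖ := norm_pos_iff.2 hv
    refine lt_of_lt_of_le (by positivity : 0 < c / 2 * ‖v‖ ^ 2) (this.trans_eq ?_)
    simp [j]
  · exact huniq θ₀ hθ₀ _ (hs θ₀ hθ₀).1 _ (Metric.mem_ball_self hr) (hsvi θ₀ hθ₀) hvi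

/-! ### A common null set, by Lindelöf and Rademacher -/

/-- There is one null set outside of which all local solution maps are differentiable. -/
theorem exists_null_set_differentiableAt [FiniteDimensional ℝ E] [FiniteDimensional ℝ P]
    [MeasurableSpace P] [BorelSpace P] (μ : Measure P) [μ.IsAddHaarMeasure]
    {φ : E → P → ℝ} {G : E × P → E} {K : Set E}
    (hφ : ∀ x θ, HasGradientAt (fun y => φ y θ) (G (x, θ)) x) (hG : ContDiff ℝ 1 G)
    (hKc : IsClosed K) (hK : Convex ℝ K) :
    ∃ N : Set P, μ N = 0 ∧ ∀ I U s, IsLocalSolutionMap φ G K I U s →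
      ∀ θ ∈ U, θ ∉ N → DifferentiableAt ℝ s θ := by
  set M : Set (E × P) := {z | IsVISolution G K z ∧
    ∀ v ≠ 0, 0 < inner ℝ v (fderiv ℝ G z (v, 0))} with hM
  have hloc : ∀ z ∈ M, ∃ I U s, IsLocalSolutionMap φ G K I U s ∧ z.1 ∈ I ∧ z.2 ∈ U :=
    fun z hz => by
      obtain ⟨I, U, s, h, hI, hU, -⟩ := exists_isLocalSolutionMap hφ hG hKc hK hz.1 hz.2
      exact ⟨I, U, s, h, hI, hU⟩
  choose! I U s hs hI hU using hloc
  obtain ⟨T, hTM, hT, hcov⟩ := TopologicalSpace.countable_cover_nhdsWithin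
    (s := M) (f := fun z => I z ×ˢ U z) fun z hz => mem_nhdsWithin_of_mem_nhds
      (((hs z hz).isOpen_left.prod (hs z hz).isOpen_right).mem_nhds ⟨hI z hz, hU z hz⟩)
  refine ⟨⋃ z ∈ T, {θ | ¬ (θ ∈ U z → DifferentiableAt ℝ (s z) θ)},
    (measure_biUnion_null_iff hT).2 fun z hz => ?_, ?_⟩
  · obtain ⟨C, hC⟩ := (hs z (hTM hz)).lipschitz
    have := hC.ae_differentiableWithinAt_of_mem (μ := μ)
    refine ae_iff.1 (this.mono fun θ hθ hθU => ?_)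
    exact (hθ hθU).differentiableAt ((hs z (hTM hz)).isOpen_right.mem_nhds hθU)
  · intro I' U' s' h' θ hθ hN
    have hmem : (s' θ, θ) ∈ M := ⟨h'.vi θ hθ, h'.posDef θ hθ _ (h'.mem θ hθ).1⟩
    obtain ⟨z, hz, hzI, hzU⟩ := mem_iUnion₂.1 (hcov hmem)
    simp only [mem_iUnion, not_exists, mem_ofPred_eq, not_not] at hN
    have hd := hN z hz hzU
    obtain ⟨C, hC⟩ := h'.lipschitz
    have hU' := h'.isOpen_right.mem_nhds hθ
    have hcont : ContinuousAt s' θ := hC.continuousOn.continuousAt hU'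
    -- By continuity `s'` stays in the box of `z` near `θ`, where uniqueness forces it to equal `s
    -- z`.
    refine hd.congr_of_eventuallyEq ?_
    filter_upwards [hU', (hs z (hTM hz)).isOpen_right.mem_nhds hzU,
      hcont ((hs z (hTM hz)).isOpen_left.mem_nhds hzI)] with η h1 h2 h3
    exact (hs z (hTM hz)).unique η h2 _ h3 (h'.vi η h1)

/-! ### The quadratic problem and first-order agreement of solutions -/

lemma hasFDerivAt_quadratic {H : E →L[ℝ] E} (hH : ∀ v w, inner ℝ v (H w) = inner ℝ w (H v))
    (b x y : E) :
    HasFDerivAt (fun y => (1 / 2 : ℝ) * inner ℝ (y - x) (H (y - x)) + inner ℝ (y - x) b)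
      (innerSL ℝ (H (y - x) + b)) y := by
  have h1 : HasFDerivAt (fun y => y - x) (ContinuousLinearMap.id ℝ E) y :=
    (hasFDerivAt_id y).sub_const x
  have h2 : HasFDerivAt (fun y => H (y - x)) H y :=
    H.hasFDerivAt.comp y h1
  refine (((h1.inner ℝ h2).const_mul (1 / 2)).add (h1.inner ℝ (hasFDerivAt_const b y))).congr_fderiv
    ?_
  ext v
  have e : inner ℝ v (H (y - x)) = inner ℝ (y - x) (H v) := hH _ _
  simp only [add_apply, smul_apply, ContinuousLinearMap.comp_apply,
    ContinuousLinearMap.prod_apply, fderivInnerCLM_apply, ContinuousLinearMap.id_apply,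
    zero_apply, inner_zero_right, zero_add, smul_eq_mul, innerSL_apply_apply]
  rw [real_inner_comm v (H (y - x) + b), inner_add_right, e]
  ring

/-- A strongly convex quadratic function has exactly one minimizer over a closed convex set. -/
lemma exists_unique_min_quadratic [FiniteDimensional ℝ E] {H : E →L[ℝ] E}
    (hH : ∀ v w, inner ℝ v (H w) = inner ℝ w (H v)) {c : ℝ} (hc : 0 < c)
    (hcH : ∀ v, c * ‖v‖ ^ 2 ≤ inner ℝ v (H v)) {K : Set E} (hKc : IsClosed K) (hK : Convex ℝ K)
    {x : E} (hx : x ∈ K) (b : E) {q : E → ℝ}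
    (hq : q = fun y => (1 / 2 : ℝ) * inner ℝ (y - x) (H (y - x)) + inner ℝ (y - x) b) :
    ∃ t, {y | y ∈ K ∧ ∀ z ∈ K, q y ≤ q z} = {t} ∧ t ∈ K ∧
      ∀ y ∈ K, 0 ≤ inner ℝ (H (t - x) + b) (y - t) := by
  have hvi : ∀ t ∈ K, (∀ z ∈ K, q t ≤ q z) → ∀ y ∈ K, 0 ≤ inner ℝ (H (t - x) + b) (y - t) := by
    intro t ht hmin y hy
    have := fderiv_nonneg_of_forall_le hK ht hy hmin (hq ▸ hasFDerivAt_quadratic hH b x t)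
    rwa [innerSL_apply_apply] at this
  have hcont : Continuous q := by rw [hq]; fun_prop
  -- Outside this radius `c / 2 * ‖y - x‖ ^ 2` dominates `‖y - x‖ * ‖b‖`, so `q y ≥ 0 = q x`.
  set R := 2 * ‖b‖ / c with hR
  have hR0 : 0 ≤ R := by positivity
  have hxB : x ∈ Metric.closedBall x R ∩ K := ⟨Metric.mem_closedBall_self hR0, hx⟩
  obtain ⟨t, ht, htmin⟩ := ((isCompact_closedBall x R).inter_right hKc).exists_isMinOn
    ⟨x, hxB⟩ hcont.continuousOn
  have hmin : ∀ z ∈ K, q t ≤ q z := by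
    intro z hz
    by_cases hzB : z ∈ Metric.closedBall x R
    · exact htmin ⟨hzB, hz⟩
    · have h0 : q t ≤ 0 := by simpa [hq] using htmin hxB
      refine h0.trans ?_
      rw [Metric.mem_closedBall, dist_eq_norm, not_le, hR, div_lt_iff₀ hc] at hzB
      have h1 := hcH (z - x)
      have h2 := neg_le_of_abs_le (abs_real_inner_le_norm (z - x) b)
      simp only [hq]
      nlinarith [norm_nonneg (z - x)]
  refine ⟨t, ?_, ht.2, hvi t ht.2 hmin⟩
  ext u
  simp only [mem_ofPred_eq, mem_singleton_iff]
  refine ⟨fun ⟨hu, humin⟩ => ?_, fun h => h ▸ ⟨ht.2, hmin⟩⟩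
  have h1 := hvi u hu humin t ht.2
  have h2 := hvi t ht.2 hmin u hu
  have h3 := norm_sub_le_of_strongly_monotone (L := 0) (G₁ := fun y => H (y - x) + b)
    (G₂ := fun y => H (y - x) + b) (x := u) (y := t) hc
    (by
      have := hcH (u - t)
      rw [real_inner_comm] at this
      simpa [← map_sub] using this) h1 h2 (by simp)
  rw [zero_div, norm_le_zero_iff] at h3
  exact sub_eq_zero.1 h3

/-- Solutions of the variational inequality and of its linearization in the first variable agree
to first order. -/
lemma isLittleO_sub_linearized_solution {G : E × P → E} (hG : ContDiff ℝ 1 G) {K : Set E}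
    {s t : P → E} {θ₁ : P} {c : ℝ} (hc : 0 < c)
    (hs : ∀ᶠ θ in 𝓝 θ₁, IsVISolution G K (s θ, θ))
    (hsO : (fun θ => s θ - s θ₁) =O[𝓝 θ₁] fun θ => θ - θ₁)
    (hcoer : ∀ᶠ θ in 𝓝 θ₁, ∀ v, c * ‖v‖ ^ 2 ≤ inner ℝ v (fderiv ℝ G (s θ₁, θ) (v, 0)))
    (ht : ∀ᶠ θ in 𝓝 θ₁, t θ ∈ K ∧
      ∀ y ∈ K, 0 ≤ inner ℝ (fderiv ℝ G (s θ₁, θ) (t θ - s θ₁, 0) + G (s θ₁, θ)) (y - t θ)) :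
    (fun θ => s θ - t θ) =o[𝓝 θ₁] fun θ => θ - θ₁ := by
  set x₁ := s θ₁ with hx₁
  set j : E →L[ℝ] E × P := ContinuousLinearMap.inl ℝ E P with hj
  have hstrict : HasStrictFDerivAt G (fderiv ℝ G (x₁, θ₁)) (x₁, θ₁) :=
    hG.contDiffAt.hasStrictFDerivAt one_ne_zero
  have hst : Tendsto s (𝓝 θ₁) (𝓝 x₁) := by
    have h0 : Tendsto (fun θ => θ - θ₁) (𝓝 θ₁) (𝓝 0) := by
      simpa using (continuous_id.sub continuous_const).tendsto θ₁ (f := fun θ : P => θ - θ₁)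
    simpa using (hsO.trans_tendsto h0).add_const x₁
  have hpair : Tendsto (fun θ => ((s θ, θ), (x₁, θ))) (𝓝 θ₁) (𝓝 ((x₁, θ₁), (x₁, θ₁))) :=
    (hst.prodMk_nhds tendsto_id).prodMk_nhds (tendsto_const_nhds.prodMk_nhds tendsto_id)
  -- The base point `(x₁, θ)` moves with `θ`, hence strict differentiability.
  have hrem : (fun θ => G (s θ, θ) - G (x₁, θ) - fderiv ℝ G (x₁, θ₁) (s θ - x₁, 0))
      =o[𝓝 θ₁] fun θ => s θ - x₁ := by
    have := hstrict.isLittleO.comp_tendsto hpair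
    refine (this.congr_left fun θ => by simp [-map_sub]).trans_isBigO (.of_bound 1 (.of_forall fun θ => ?_))
    simp
  have hcont : Continuous fun z => (fderiv ℝ G z).comp j :=
    (hG.continuous_fderiv one_ne_zero).clm_comp continuous_const
  -- Replaces the derivative at `θ₁` by the one at `θ`, which the quadratic problem uses.
  have hrem2 : (fun θ => fderiv ℝ G (x₁, θ) (s θ - x₁, 0) - fderiv ℝ G (x₁, θ₁) (s θ - x₁, 0))
      =o[𝓝 θ₁] fun θ => s θ - x₁ := by
    refine Asymptotics.isLittleO_iff.2 fun ε hε => ?_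
    have hc' : Tendsto (fun θ => (fderiv ℝ G (x₁, θ)).comp j) (𝓝 θ₁)
        (𝓝 ((fderiv ℝ G (x₁, θ₁)).comp j)) :=
      (hcont.tendsto (x₁, θ₁)).comp (tendsto_const_nhds.prodMk_nhds tendsto_id)
    filter_upwards [Metric.tendsto_nhds.1 hc' ε hε] with θ hθ
    rw [dist_eq_norm] at hθ
    simpa [j] using ContinuousLinearMap.le_of_opNorm_le _ hθ.le (s θ - x₁)
  have hR := (hrem.sub hrem2).trans_isBigO hsO
  refine Asymptotics.IsBigO.trans_isLittleO (.of_bound (1 / c) ?_) hR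
  filter_upwards [hs, hcoer, ht] with θ h1 h2 h3
  set H := (fderiv ℝ G (x₁, θ)).comp j with hH
  have eH : ∀ v, fderiv ℝ G (x₁, θ) (v, 0) = H v := fun v => by simp [H, j]
  simp only [eH] at h2 h3 ⊢
  have hm : c * ‖t θ - s θ‖ ^ 2 ≤
      inner ℝ ((H (t θ - x₁) + G (x₁, θ)) - (H (s θ - x₁) + G (x₁, θ))) (t θ - s θ) := by
    have := h2 (t θ - s θ)
    rw [real_inner_comm] at this
    simpa [← map_sub] using this
  have := norm_sub_le_of_strongly_monotone (G₁ := fun y => H (y - x₁) + G (x₁, θ))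
    (G₂ := fun y => G (y, θ)) hc hm (h3.2 _ h1.1) (h1.2 _ h3.1) le_rfl
  rw [norm_sub_rev, one_div_mul_eq_div]
  refine this.trans_eq ?_
  rw [norm_sub_rev]
  congr 2
  abel

/-- At `θ₁` itself the bound forces `s θ₁ = t θ₁`, so the difference has derivative zero there. -/
lemma hasFDerivAt_iff_of_sub_isLittleO {s t : P → E} {θ₁ : P} {D : P →L[ℝ] E}
    (h : (fun θ => s θ - t θ) =o[𝓝 θ₁] fun θ => θ - θ₁) :
    HasFDerivAt s D θ₁ ↔ HasFDerivAt t D θ₁ := by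
  have h0 : HasFDerivAt (fun θ => s θ - t θ) (0 : P →L[ℝ] E) θ₁ := by
    have e : s θ₁ - t θ₁ = 0 := by
      simpa using h.isBigO.eq_zero_imp.self_of_nhds
    rw [hasFDerivAt_iff_isLittleO]
    simpa [e] using h
  refine ⟨fun hs => ?_, fun ht => ?_⟩
  · have := hs.sub h0
    rw [sub_zero] at this
    exact this.congr_of_eventuallyEq (.of_forall fun θ => by simp)
  · have := ht.add h0
    rw [add_zero] at this
    exact this.congr_of_eventuallyEq (.of_forall fun θ => by simp)

end

/-! ### From the Karush-Kuhn-Tucker conditions to the variational inequality -/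

lemma ConvexOn.inner_gradient_le {E : Type*} [NormedAddCommGroup E] [InnerProductSpace ℝ E]
    [CompleteSpace E] {g : E → ℝ} (hg : ConvexOn ℝ Set.univ g) {x : E}
    (hd : DifferentiableAt ℝ g x) (y : E) : inner ℝ (gradient g x) (y - x) ≤ g y - g x := by
  have hc : ConvexOn ℝ Set.univ (g ∘ AffineMap.lineMap (k := ℝ) x y) := by
    simpa using hg.comp_affineMap (AffineMap.lineMap (k := ℝ) x y)
  have hl : HasDerivAt (AffineMap.lineMap (k := ℝ) x y) (y - x) 0 :=
    AffineMap.hasDerivAt_lineMap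
  have hd' : HasFDerivAt g (fderiv ℝ g x) (AffineMap.lineMap (k := ℝ) x y (0 : ℝ)) := by
    simpa using hd.hasFDerivAt
  have h1 := hc.le_slope_of_hasDerivAt (mem_univ 0) (mem_univ 1) one_pos
    (hd'.comp_hasDerivAt (0 : ℝ) hl)
  have e : inner ℝ (gradient g x) (y - x) = fderiv ℝ g x (y - x) := by
    rw [← toDual_gradient]; rfl
  rw [e]
  simpa [slope] using h1

section

variable {n m l : ℕ} {g : Fin m → EuclideanSpace ℝ (Fin n) → ℝ}
  (h : Fin l → EuclideanSpace ℝ (Fin n) →ᵃ[ℝ] ℝ)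

lemma convex_feasibleSet (hg : ∀ i, ConvexOn ℝ Set.univ (g i)) : Convex ℝ (feasibleSet g h) := by
  have : feasibleSet g h = (⋂ i, {x | g i x ≤ 0}) ∩ ⋂ j, h j ⁻¹' {0} := by
    ext x; simp [feasibleSet]
  rw [this]
  refine (convex_iInter fun i => ?_).inter
    (convex_iInter fun j => (convex_singleton 0).affine_preimage _)
  simpa using (hg i).convex_le 0

lemma isClosed_feasibleSet (hg : ∀ i, ConvexOn ℝ Set.univ (g i)) :
    IsClosed (feasibleSet g h) := by
  have : feasibleSet g h = (⋂ i, {x | g i x ≤ 0}) ∩ ⋂ j, {x | h j x = 0} := by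
    ext x; simp [feasibleSet]
  rw [this]
  refine (isClosed_iInter fun i => ?_).inter (isClosed_iInter fun j => ?_)
  · exact isClosed_le (continuousOn_univ.1 ((hg i).continuousOn isOpen_univ)) continuous_const
  · exact isClosed_eq (h j).continuous_of_finiteDimensional continuous_const

/-- For a convex problem the Karush-Kuhn-Tucker conditions give the variational inequality. -/
lemma IsStrictLocalMinimizer.inner_gradient_nonneg {φ : EuclideanSpace ℝ (Fin n) → ℝ}
    {h : Fin l → EuclideanSpace ℝ (Fin n) →ᵃ[ℝ] ℝ}
    (hg : ∀ i, ConvexOn ℝ Set.univ (g i)) {x : EuclideanSpace ℝ (Fin n)}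
    (hx : IsStrictLocalMinimizer φ g h x) {y : EuclideanSpace ℝ (Fin n)}
    (hy : y ∈ feasibleSet g h) : 0 ≤ inner ℝ (gradient φ x) (y - x) := by
  obtain ⟨μ, ν, hμ, hsum, hcomp⟩ := hx.kkt
  have h1 : ∀ i, inner ℝ (μ i • gradient (g i) x) (y - x) ≤ 0 := fun i => by
    rw [real_inner_smul_left]
    nlinarith [mul_le_mul_of_nonneg_left ((hg i).inner_gradient_le (hx.diff i) y) (hμ i),
      hcomp i, mul_nonpos_of_nonneg_of_nonpos (hμ i) (hy.1 i)]
  have h2 : ∀ j, inner ℝ (ν j • gradient (fun y => h j y) x) (y - x) = 0 := fun j => by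
    have hd : DifferentiableAt ℝ (h j) x := by
      have : (h j : EuclideanSpace ℝ (Fin n) → ℝ) =
          fun y => LinearMap.toContinuousLinearMap (h j).linear y + h j 0 := by
        simpa [Pi.add_def] using (h j).decomp
      rw [this]
      fun_prop
    have hc : ConvexOn ℝ Set.univ (h j) := by
      simpa [Function.comp_def] using
        (convexOn_id (convex_univ (𝕜 := ℝ) (E := ℝ))).comp_affineMap (h j)
    have key : ∀ z, inner ℝ (gradient (fun y => h j y) x) (z - x) ≤ h j z - h j x :=
      hc.inner_gradient_le hd
    have k1 := key y
    -- The reflection of `y` in `x` also satisfies the equality constraints, so the gradient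
    -- inequality holds with both signs.
    have k2 := key ((2 : ℝ) • x - y)
    have e1 : (2 : ℝ) • x - y - x = -(y - x) := by module
    have e2 : h j ((2 : ℝ) • x - y) = 0 := by
      have : (2 : ℝ) • x - y = AffineMap.lineMap (k := ℝ) x y (-1 : ℝ) := by
        rw [AffineMap.lineMap_apply_module]; module
      rw [this, AffineMap.apply_lineMap, hy.2 j, hx.feasible.2 j]
      simp
    rw [e1, inner_neg_right, e2, hx.feasible.2 j] at k2
    rw [hy.2 j, hx.feasible.2 j] at k1
    rw [real_inner_smul_left]
    have : inner ℝ (gradient (fun y => h j y) x) (y - x) = 0 := by linarith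
    rw [this, mul_zero]
  have h3 : inner ℝ (gradient φ x + ∑ i, μ i • gradient (g i) x +
      ∑ j, ν j • gradient (fun y => h j y) x) (y - x) = 0 := by
    rw [hsum, inner_zero_left]
  rw [inner_add_left, inner_add_left, sum_inner, sum_inner,
    Finset.sum_eq_zero fun j _ => h2 j] at h3
  have := Finset.sum_nonpos fun i (_ : i ∈ Finset.univ) => h1 i
  linarith

end

/-! ### Regularity of the partial gradient and the Hessian -/

section

variable {E P : Type*} [NormedAddCommGroup E] [InnerProductSpace ℝ E] [CompleteSpace E]
  [NormedAddCommGroup P] [NormedSpace ℝ P] {f : E → P → ℝ}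

lemma hasGradientAt_partial {k : WithTop ℕ∞} (hk : k ≠ 0)
    (hf : ContDiff ℝ k fun z : E × P => f z.1 z.2) (x : E) (θ : P) :
    HasGradientAt (fun y => f y θ) (gradient (fun y => f y θ) x) x := by
  refine DifferentiableAt.hasGradientAt ?_
  have := hf.differentiable hk
  exact (this.comp (differentiable_id.prodMk (differentiable_const θ))).differentiableAt

/-- The partial gradient is the Riesz representative of the full derivative restricted to `E`, so
one order of smoothness is lost. -/
lemma contDiff_partial_gradient (hf : ContDiff ℝ 2 fun z : E × P => f z.1 z.2) :
    ContDiff ℝ 1 fun z : E × P => gradient (fun y => f y z.2) z.1 := by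
  have e : (fun z : E × P => gradient (fun y => f y z.2) z.1) = fun z =>
      (InnerProductSpace.toDual ℝ E).symm.toContinuousLinearEquiv
        ((fderiv ℝ (fun z : E × P => f z.1 z.2) z).comp (ContinuousLinearMap.inl ℝ E P)) := by
    funext z
    have h1 : HasFDerivAt (fun y : E => (y, z.2)) (ContinuousLinearMap.inl ℝ E P) z.1 :=
      hasFDerivAt_prodMk_left z.1 z.2
    have h2 : HasFDerivAt (fun z : E × P => f z.1 z.2)
      (fderiv ℝ (fun z : E × P => f z.1 z.2) z) (z.1, z.2) :=
        (hf.differentiable two_ne_zero z).hasFDerivAt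
    have h3 := (h2.comp z.1 h1).fderiv
    change (InnerProductSpace.toDual ℝ E).symm (fderiv ℝ _ z.1) = _
    rw [← h3]
    rfl
  rw [e]
  refine (ContinuousLinearEquiv.contDiff _).comp ?_
  exact (hf.fderiv_right (m := 1) (by norm_num)).clm_comp contDiff_const

end

section

variable {n : ℕ} {P : Type*} [NormedAddCommGroup P] [NormedSpace ℝ P]
  {f : EuclideanSpace ℝ (Fin n) → P → ℝ}

lemma hessian_partial_apply
    (hf : ContDiff ℝ 2 fun z : EuclideanSpace ℝ (Fin n) × P => f z.1 z.2)
    (x v : EuclideanSpace ℝ (Fin n)) (θ : P) :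
    hessian (fun y => f y θ) x v =
      fderiv ℝ (fun z : EuclideanSpace ℝ (Fin n) × P => gradient (fun y => f y z.2) z.1)
        (x, θ) (v, 0) := by
  have h1 : HasFDerivAt (fun y : EuclideanSpace ℝ (Fin n) => (y, θ))
      (ContinuousLinearMap.inl ℝ _ P) x := hasFDerivAt_prodMk_left x θ
  have h2 := ((contDiff_partial_gradient hf).differentiable one_ne_zero (x, θ)).hasFDerivAt
  have h3 := (h2.comp x h1).fderiv
  have h4 : hessian (fun y => f y θ) x = _ := h3
  rw [h4]
  simp

lemma inner_hessian_symm {φ : EuclideanSpace ℝ (Fin n) → ℝ} (hφ : ContDiff ℝ 2 φ)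
    (x v w : EuclideanSpace ℝ (Fin n)) :
    inner ℝ v (hessian φ x w) = inner ℝ w (hessian φ x v) := by
  have hsymm : IsSymmSndFDerivAt ℝ φ x := hφ.contDiffAt.isSymmSndFDerivAt (by simp)
  have key : ∀ a b, inner ℝ a (hessian φ x b) = fderiv ℝ (fderiv ℝ φ) x b a := fun a b => by
    have hd : DifferentiableAt ℝ (fderiv ℝ φ) x :=
      (hφ.fderiv_right (m := 1) (by norm_num)).differentiable one_ne_zero x
    have h1 := ((InnerProductSpace.toDual ℝ (EuclideanSpace ℝ (Fin n))).symm.toContinuousLinearEquiv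
      |>.hasFDerivAt.comp x hd.hasFDerivAt).fderiv
    have h2 : hessian φ x = _ := h1
    rw [h2, real_inner_comm]
    exact InnerProductSpace.toDual_symm_apply
  rw [key, key]
  exact hsymm.eq w v

end

/-! ### The main theorem -/

theorem theorem3 {n m l p : ℕ}
    (f : EuclideanSpace ℝ (Fin n) → EuclideanSpace ℝ (Fin p) → ℝ)
    (hf : ContDiff ℝ 2 (fun z : EuclideanSpace ℝ (Fin n) × EuclideanSpace ℝ (Fin p) => f z.1 z.2))
    (g : Fin m → EuclideanSpace ℝ (Fin n) → ℝ)
    (hg : ∀ i, ConvexOn ℝ Set.univ (g i))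
    (h : Fin l → EuclideanSpace ℝ (Fin n) →ᵃ[ℝ] ℝ)
    (slater : ∃ x ∈ feasibleSet g h, ∀ i, g i x < 0) :
    ∃ N : Set (EuclideanSpace ℝ (Fin p)), volume N = 0 ∧
      ∀ (θ₀ : EuclideanSpace ℝ (Fin p)) (x : EuclideanSpace ℝ (Fin n)),
        IsStrictLocalMinimizer (fun y => f y θ₀) g h x →
        ∃ (I : Set (EuclideanSpace ℝ (Fin n))) (U : Set (EuclideanSpace ℝ (Fin p)))
          (s : EuclideanSpace ℝ (Fin p) → EuclideanSpace ℝ (Fin n)),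
          IsOpen I ∧ Convex ℝ I ∧ x ∈ I ∧ IsOpen U ∧ θ₀ ∈ U ∧
          -- on `U`, `s` is the local solution map, through `x` at `θ₀`
          (∀ θ ∈ U, argminSet (fun y => f y θ) (I ∩ feasibleSet g h) = {s θ}) ∧
          s θ₀ = x ∧
          -- it is differentiable outside the null set
          (∀ θ ∈ U, θ ∉ N → DifferentiableAt ℝ s θ) ∧
          -- its derivatives are those of the solutions of the local quadratic problem
          (∀ θ₁ ∈ U, ∃ t : EuclideanSpace ℝ (Fin p) → EuclideanSpace ℝ (Fin n),
            (∀ᶠ θ in 𝓝 θ₁,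
              argminSet (localQuadratic (fun y => f y θ) (s θ₁)) (feasibleSet g h) = {t θ}) ∧
            ∀ D : EuclideanSpace ℝ (Fin p) →L[ℝ] EuclideanSpace ℝ (Fin n),
              HasFDerivAt s D θ₁ ↔ HasFDerivAt t D θ₁) := by
  set K := feasibleSet g h with hKdef
  set G : EuclideanSpace ℝ (Fin n) × EuclideanSpace ℝ (Fin p) → EuclideanSpace ℝ (Fin n) :=
    fun z => gradient (fun y => f y z.2) z.1 with hGdef
  have hφ : ∀ x θ, HasGradientAt (fun y => f y θ) (G (x, θ)) x :=
    hasGradientAt_partial two_ne_zero hf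
  have hG : ContDiff ℝ 1 G := contDiff_partial_gradient hf
  have hKc : IsClosed K := isClosed_feasibleSet h hg
  have hK : Convex ℝ K := convex_feasibleSet h hg
  have hfθ : ∀ θ, ContDiff ℝ 2 fun y => f y θ := fun θ =>
    hf.comp (contDiff_id.prodMk contDiff_const)
  have hess : ∀ x θ v, hessian (fun y => f y θ) x v = fderiv ℝ G (x, θ) (v, 0) :=
    fun x θ v => hessian_partial_apply hf x v θ
  obtain ⟨N, hN, hdiff⟩ := exists_null_set_differentiableAt volume hφ hG hKc hK
  refine ⟨N, hN, fun θ₀ x hx => ?_⟩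
  obtain ⟨I, U, s, hs, hxI, hθU, hsx⟩ := exists_isLocalSolutionMap hφ hG hKc hK (x₀ := x)
    (θ₀ := θ₀) ⟨hx.feasible, fun y hy => hx.inner_gradient_nonneg hg hy⟩
    (fun v hv => by rw [← hess]; exact hx.posDef v hv)
  refine ⟨I, U, s, hs.isOpen_left, hs.convex, hxI, hs.isOpen_right, hθU, fun θ hθ => ?_, hsx,
    hdiff I U s hs, fun θ₁ hθ₁ => ?_⟩
  · ext z
    simp only [argminSet, mem_ofPred_eq, mem_singleton_iff]
    exact ⟨fun hz => hs.unique_min θ hθ z hz.1 hz.2,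
      fun hz => hz ▸ ⟨hs.mem θ hθ, hs.isMinOn θ hθ⟩⟩
  have hU := hs.isOpen_right.mem_nhds hθ₁
  set H : EuclideanSpace ℝ (Fin p) → EuclideanSpace ℝ (Fin n) →L[ℝ] EuclideanSpace ℝ (Fin n) :=
    fun θ => hessian (fun y => f y θ) (s θ₁) with hHdef
  have hHcont : Continuous H := by
    have e : H = fun θ => (fderiv ℝ G (s θ₁, θ)).comp (ContinuousLinearMap.inl ℝ _ _) := by
      funext θ; ext1 v; simp [H, hess]
    rw [e]
    exact ((hG.continuous_fderiv one_ne_zero).comp (by fun_prop :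
      Continuous fun θ => (s θ₁, θ))).clm_comp continuous_const
  obtain ⟨c, hc, hcH⟩ := exists_coercive (H θ₁) fun v hv => by
    rw [hess]; exact hs.posDef θ₁ hθ₁ _ (hs.mem θ₁ hθ₁).1 v hv
  -- The Hessian is taken at the fixed point `s θ₁`; only `θ` varies.
  have hcoer : ∀ᶠ θ in 𝓝 θ₁, ∀ v, c / 2 * ‖v‖ ^ 2 ≤ inner ℝ v (H θ v) := by
    filter_upwards [Metric.tendsto_nhds.1 (hHcont.tendsto θ₁) (c / 2) (by positivity)] with θ hθ
    rw [dist_eq_norm] at hθ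
    exact coercive_of_norm_sub_le hcH hθ.le
  have hex : ∀ᶠ θ in 𝓝 θ₁, ∃ t, argminSet (localQuadratic (fun y => f y θ) (s θ₁)) K = {t} ∧
      t ∈ K ∧ ∀ y ∈ K, 0 ≤ inner ℝ (fderiv ℝ G (s θ₁, θ) (t - s θ₁, 0) + G (s θ₁, θ)) (y - t) := by
    filter_upwards [hcoer] with θ hθ
    simp only [← hess]
    exact exists_unique_min_quadratic (inner_hessian_symm (hfθ θ) (s θ₁)) (half_pos hc) hθ hKc hK
      (hs.mem θ₁ hθ₁).2 (G (s θ₁, θ)) rfl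
  obtain ⟨t, ht⟩ : ∃ t : EuclideanSpace ℝ (Fin p) → EuclideanSpace ℝ (Fin n), ∀ᶠ θ in 𝓝 θ₁,
      argminSet (localQuadratic (fun y => f y θ) (s θ₁)) K = {t θ} ∧ t θ ∈ K ∧
      ∀ y ∈ K, 0 ≤ inner ℝ (fderiv ℝ G (s θ₁, θ) (t θ - s θ₁, 0) + G (s θ₁, θ)) (y - t θ) :=
    hex.choice
  refine ⟨t, ht.mono fun θ hθ => hθ.1, fun D => hasFDerivAt_iff_of_sub_isLittleO ?_⟩
  obtain ⟨C, hC⟩ := hs.lipschitz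
  refine isLittleO_sub_linearized_solution hG (half_pos hc) ?_ ?_ ?_ (ht.mono fun θ hθ => hθ.2)
  · filter_upwards [hU] with θ hθ using hs.vi θ hθ
  · refine .of_bound C ?_
    filter_upwards [hU] with θ hθ
    simpa [dist_eq_norm] using hC.dist_le_mul θ hθ θ₁ hθ₁
  · simpa only [H, hess] using hcoer
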